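/- For a Lebesgue measurable set $F\subset\mathbb R^n$ let $$\operatorname{Per}(F)=\sup\Big\{\int_F \operatorname{div}\varphi\,dx:\ \varphi\in C^1_c(\mathbb R^n;\mathbb R^n),\ |\varphi|\le 1\Big\}\in[0,\infty].$$ A set $E\subset\mathbb R^n$ is a *minimizing hull* if $|\partial E|=0$ and $\operatorname{Per}(E)\le\operatorname{Per}(F)$ for every measurable $F\supset E$ such that $F\setminus E$ is relatively compact. Let $E\subset\mathbb R^n$ be a minimizing hull of finite perimeter and let $\Omega\subset E$ (the obstacle). For $h>0$, let $T_h(E)$ denote the maximal minimizer of $$F\longmapsto \operatorname{Per}(F)+\frac1h\int_{F\Delta E}\operatorname{dist}(x,\partial E)\,dx$$ among all measurable sets $F$ with $\Omega\subset F$ and $|F\setminus E|<\infty$ (the last condition is automatic for every $F$ of finite energy when $E$ is bounded); that is, $T_h(E)$ is a minimizer which contains every other minimizer up to a null set, and it is thereby determined up to a null set. Here $\operatorname{dist}(x,\emptyset)=\infty$. If $h>\tilde h>0$, then $T_h(E)\subset T_{\tilde h}(E)$ up to a null set, i.e. $|T_h(E)\setminus T_{\tilde h}(E)|=0$, for the maximal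 minimizers $T_h(E)$ and $T_{\tilde h}(E)$. -/

import Mathlib

open MeasureTheory

noncomputable section

namespace ObstacleFlow

/-- Divergence of a vector field on `ℝⁿ`, as the sum of its diagonal partial derivatives. -/
def divergence {n : ℕ} (φ : EuclideanSpace ℝ (Fin n) → EuclideanSpace ℝ (Fin n))
    (x : EuclideanSpace ℝ (Fin n)) : ℝ :=
  ∑ i, fderiv ℝ φ x (EuclideanSpace.single i 1) i

/-- De Giorgi perimeter of a (Lebesgue measurable) set: the supremum of `∫_E div φ` over
compactly supported `C¹` vector fields `φ` with `|φ| ≤ 1`. -/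
def perimeter {n : ℕ} (E : Set (EuclideanSpace ℝ (Fin n))) : ENNReal :=
  ⨆ (φ : EuclideanSpace ℝ (Fin n) → EuclideanSpace ℝ (Fin n)) (_ : ContDiff ℝ 1 φ)
    (_ : HasCompactSupport φ) (_ : ∀ x, ‖φ x‖ ≤ 1),
    ENNReal.ofReal (∫ x in E, divergence φ x)

/-- `E` is a minimizing hull: `|∂E| = 0` and `Per E ≤ Per F` for every measurable `F ⊇ E` such
that `F \ E` is relatively compact. (`|∂E| = 0` makes `E` Lebesgue measurable.) -/
structure IsMinimizingHull {n : ℕ} (E : Set (EuclideanSpace ℝ (Fin n))) : Prop where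
  frontier_null : volume (frontier E) = 0
  perimeter_le : ∀ F : Set (EuclideanSpace ℝ (Fin n)), NullMeasurableSet F volume →
    E ⊆ F → Bornology.IsBounded (F \ E) → perimeter E ≤ perimeter F

/-- The energy `Per F + (1/h) ∫_{F Δ E} dist(x, ∂E) dx`, where `dist(x, ∂E) = |d_E(x)|` is the
absolute value of the signed distance to `E` (equal to `∞` if `∂E = ∅`). -/
def energy {n : ℕ} (h : ℝ) (E F : Set (EuclideanSpace ℝ (Fin n))) : ENNReal :=
  perimeter F +
    ENNReal.ofReal (1 / h) * ∫⁻ x in symmDiff F E, Metric.infEDist x (frontier E)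

/-- Competitors: measurable sets containing the obstacle `Ω` and exceeding `E` by a set of finite
measure. For bounded `E` the last condition holds for every `F` of finite energy. -/
structure IsAdmissible {n : ℕ} (Ω E F : Set (EuclideanSpace ℝ (Fin n))) : Prop where
  measurable : NullMeasurableSet F volume
  obstacle_subset : Ω ⊆ F
  finite_excess : volume (F \ E) < ⊤

/-- `F` is a minimizer of the energy among the competitors. -/
structure IsStepMinimizer {n : ℕ} (h : ℝ) (Ω E F : Set (EuclideanSpace ℝ (Fin n))) : Prop where
  admissible : IsAdmissible Ω E F
  energy_le : ∀ G : Set (EuclideanSpace ℝ (Fin n)), IsAdmissible Ω E G →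
    energy h E F ≤ energy h E G

/-- `F = T_h(E)`: `F` is the maximal minimizer, that is, a minimizer which contains every other
minimizer up to a null set. This determines `F` up to a null set. -/
structure IsStep {n : ℕ} (h : ℝ) (Ω E F : Set (EuclideanSpace ℝ (Fin n))) : Prop where
  minimizer : IsStepMinimizer h Ω E F
  maximal : ∀ G : Set (EuclideanSpace ℝ (Fin n)), IsStepMinimizer h Ω E G →
    volume (G \ F) = 0

end ObstacleFlow

end

open MeasureTheory Filter Topology ContinuousLinearMap Convolution

noncomputable section

namespace ObstacleFlow

variable {n : ℕ}

/-! Let `F` and `F'` be minimizers for `h` and `h' < h`. Both stay inside `E` up to null sets, so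
the penalty only weighs what is missing from `E`. Compare `F` with `F ∩ F'` and `F'` with `F ∪ F'`,
and add: submodularity of the perimeter cancels all perimeter terms and leaves `(1/h') I ≤ (1/h) I`,
where `I` is the integral of the distance to `∂E` over `F \ F'`. As `I` is finite, it vanishes; the
distance is positive off the null set `∂E`, so `F \ F'` is null.

Two facts carry this. Submodularity (`perimeter_inter_add_perimeter_union_le`) is proved by duality:
for mollified indicators `u`, `v`, the products `u v` and `u + v - u v` stand for intersection and
union, and convex combinations of two test fields with weights `u` and `v` are again test fields.

Confinement to `E` needs the hull property for supersets of finite excess volume, while the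
definition only allows bounded excess (`IsMinimizingHull.perimeter_le_of_volume_lt_top`). The excess
is cut at a large radius. Finite volume provides radii where the cut costs little, and finite
perimeter makes the contribution of `E` far out small. -/

/-- The fields tested against in the definition of the perimeter. -/
structure IsTestField (φ : EuclideanSpace ℝ (Fin n) → EuclideanSpace ℝ (Fin n)) : Prop where
  contDiff : ContDiff ℝ 1 φ
  hasCompactSupport : HasCompactSupport φ
  norm_le : ∀ x, ‖φ x‖ ≤ 1

lemma isTestField_zero :
    IsTestField (fun _ => 0 : EuclideanSpace ℝ (Fin n) → EuclideanSpace ℝ (Fin n)) :=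
  ⟨contDiff_const, HasCompactSupport.zero, by simp⟩

/-! ### Testing the perimeter; calculus of the divergence -/

lemma perimeter_le_iff {F : Set (EuclideanSpace ℝ (Fin n))} {c : ℝ} (hc : 0 ≤ c) :
    perimeter F ≤ ENNReal.ofReal c ↔ ∀ φ, IsTestField φ → ∫ x in F, divergence φ x ≤ c := by
  unfold perimeter
  simp only [iSup_le_iff, ENNReal.ofReal_le_ofReal_iff hc]
  exact ⟨fun h φ hφ => h φ hφ.1 hφ.2 hφ.3, fun h φ h1 h2 h3 => h φ ⟨h1, h2, h3⟩⟩

lemma IsTestField.integral_le {F : Set (EuclideanSpace ℝ (Fin n))} (hF : perimeter F ≠ ⊤)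
    {φ : EuclideanSpace ℝ (Fin n) → EuclideanSpace ℝ (Fin n)} (hφ : IsTestField φ) :
    ∫ x in F, divergence φ x ≤ (perimeter F).toReal :=
  (perimeter_le_iff ENNReal.toReal_nonneg).1 (ENNReal.ofReal_toReal hF).ge φ hφ

@[simp]
lemma divergence_zero :
    divergence (fun _ => 0 : EuclideanSpace ℝ (Fin n) → EuclideanSpace ℝ (Fin n)) = 0 := by
  ext x
  simp [divergence]

lemma continuous_divergence {φ : EuclideanSpace ℝ (Fin n) → EuclideanSpace ℝ (Fin n)}
    (hφ : ContDiff ℝ 1 φ) : Continuous (divergence φ) := by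
  have := hφ.continuous_fderiv one_ne_zero
  unfold divergence
  fun_prop

lemma hasCompactSupport_divergence
    {φ : EuclideanSpace ℝ (Fin n) → EuclideanSpace ℝ (Fin n)}
    (hφ : HasCompactSupport φ) : HasCompactSupport (divergence φ) := by
  refine (hφ.fderiv (𝕜 := ℝ)).mono fun x hx => ?_
  contrapose! hx
  simp only [Function.mem_support, not_not] at hx ⊢
  simp [divergence, hx]

lemma integrable_divergence {φ : EuclideanSpace ℝ (Fin n) → EuclideanSpace ℝ (Fin n)}
    (hφ : ContDiff ℝ 1 φ) (hc : HasCompactSupport φ) : Integrable (divergence φ) :=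
  (continuous_divergence hφ).integrable_of_hasCompactSupport (hasCompactSupport_divergence hc)

lemma divergence_add {φ ψ : EuclideanSpace ℝ (Fin n) → EuclideanSpace ℝ (Fin n)}
    (hφ : ContDiff ℝ 1 φ) (hψ : ContDiff ℝ 1 ψ) (x : EuclideanSpace ℝ (Fin n)) :
    divergence (fun y => φ y + ψ y) x = divergence φ x + divergence ψ x := by
  unfold divergence
  rw [fderiv_fun_add (hφ.differentiable one_ne_zero x) (hψ.differentiable one_ne_zero x)]
  simp [Finset.sum_add_distrib]

lemma divergence_smul {χ : EuclideanSpace ℝ (Fin n) → ℝ}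
    {φ : EuclideanSpace ℝ (Fin n) → EuclideanSpace ℝ (Fin n)}
    (hχ : ContDiff ℝ 1 χ) (hφ : ContDiff ℝ 1 φ) (x : EuclideanSpace ℝ (Fin n)) :
    divergence (fun y => χ y • φ y) x = χ x * divergence φ x + fderiv ℝ χ x (φ x) := by
  unfold divergence
  rw [fderiv_fun_smul (hχ.differentiable one_ne_zero x) (hφ.differentiable one_ne_zero x)]
  have h : φ x = ∑ i, φ x i • EuclideanSpace.single i (1 : ℝ) := by
    ext j
    simp [Finset.sum_apply, Pi.single_apply]
  conv_rhs => rw [h, map_sum]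
  simp [Finset.sum_add_distrib, Finset.mul_sum, mul_comm]

lemma divergence_comp_add (φ : EuclideanSpace ℝ (Fin n) → EuclideanSpace ℝ (Fin n))
    (t x : EuclideanSpace ℝ (Fin n)) :
    divergence (fun y => φ (y + t)) x = divergence φ (x + t) := by
  simp [divergence, fderiv_comp_add_right]

/-- Integration by parts against the constant function `1`, one coordinate at a time. -/
lemma integral_divergence {φ : EuclideanSpace ℝ (Fin n) → EuclideanSpace ℝ (Fin n)}
    (hφ : ContDiff ℝ 1 φ) (hc : HasCompactSupport φ) : ∫ x, divergence φ x = 0 := by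
  have hcont := hφ.continuous_fderiv one_ne_zero
  have hint : ∀ v, Integrable (fun x => fderiv ℝ φ x v) := fun v =>
    (hcont.clm_apply continuous_const).integrable_of_hasCompactSupport (hc.fderiv_apply ℝ v)
  have key : ∀ v, ∫ x, fderiv ℝ φ x v = 0 := fun v => by
    have := integral_smul_fderiv_eq_neg_fderiv_smul_of_integrable (μ := volume) (𝕜 := ℝ)
      (f := fun _ => (1 : ℝ)) (g := φ) (v := v) (by simp) (by simpa using hint v)
      (by simpa using hφ.continuous.integrable_of_hasCompactSupport hc)
      (fun _ _ => by fun_prop) (fun x _ => hφ.differentiable one_ne_zero x)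
    simpa using this
  unfold divergence
  have hproj : ∀ i v, (fun x => fderiv ℝ φ x v i) =
      fun x => EuclideanSpace.proj (𝕜 := ℝ) i (fderiv ℝ φ x v) := fun i v => rfl
  rw [integral_finsetSum]
  · refine Finset.sum_eq_zero fun i _ => ?_
    rw [hproj, ContinuousLinearMap.integral_comp_comm _ (hint _), key, map_zero]
  · intro i _
    rw [hproj]
    exact ContinuousLinearMap.integrable_comp _ (hint _)

lemma IsTestField.comp_add {φ : EuclideanSpace ℝ (Fin n) → EuclideanSpace ℝ (Fin n)}
    (hφ : IsTestField φ) (t : EuclideanSpace ℝ (Fin n)) : IsTestField (fun x => φ (x + t)) where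
  contDiff := hφ.contDiff.comp (contDiff_id.add contDiff_const)
  hasCompactSupport := hφ.hasCompactSupport.comp_homeomorph (Homeomorph.addRight t)
  norm_le _ := hφ.norm_le _

lemma IsTestField.smul {φ : EuclideanSpace ℝ (Fin n) → EuclideanSpace ℝ (Fin n)}
    (hφ : IsTestField φ) {χ : EuclideanSpace ℝ (Fin n) → ℝ} (hχ : ContDiff ℝ 1 χ)
    (h0 : ∀ x, 0 ≤ χ x) (h1 : ∀ x, χ x ≤ 1) : IsTestField (fun x => χ x • φ x) := by
  refine ⟨hχ.smul hφ.contDiff, HasCompactSupport.smul_left (f := χ) hφ.hasCompactSupport,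
    fun x => ?_⟩
  · rw [norm_smul, Real.norm_of_nonneg (h0 x)]
    exact mul_le_one₀ (h1 x) (norm_nonneg _) (hφ.norm_le x)

lemma IsTestField.interpolate {φ ψ : EuclideanSpace ℝ (Fin n) → EuclideanSpace ℝ (Fin n)}
    (hφ : IsTestField φ) (hψ : IsTestField ψ) {χ : EuclideanSpace ℝ (Fin n) → ℝ}
    (hχ : ContDiff ℝ 1 χ) (h0 : ∀ x, 0 ≤ χ x) (h1 : ∀ x, χ x ≤ 1) :
    IsTestField (fun x => χ x • φ x + (1 - χ x) • ψ x) := by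
  refine ⟨(hχ.smul hφ.contDiff).add ((contDiff_const.sub hχ).smul hψ.contDiff),
    (HasCompactSupport.smul_left (f := χ) hφ.hasCompactSupport).add
      (HasCompactSupport.smul_left (f := fun x => 1 - χ x) hψ.hasCompactSupport), fun x => ?_⟩
  · have h0 := h0 x
    have h1 := sub_nonneg.2 (h1 x)
    calc ‖χ x • φ x + (1 - χ x) • ψ x‖ ≤ χ x * ‖φ x‖ + (1 - χ x) * ‖ψ x‖ := by
          refine (norm_add_le _ _).trans_eq ?_
          rw [norm_smul, norm_smul, Real.norm_of_nonneg h0, Real.norm_of_nonneg h1]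
      _ ≤ χ x * 1 + (1 - χ x) * 1 := by gcongr <;> apply_rules [IsTestField.norm_le]
      _ = 1 := by ring

/-! ### Mollified indicator functions -/

/-- The mollification of the indicator function of a set. -/
def mollify (ρ : ContDiffBump (0 : EuclideanSpace ℝ (Fin n)))
    (A : Set (EuclideanSpace ℝ (Fin n))) : EuclideanSpace ℝ (Fin n) → ℝ :=
  ρ.normed volume ⋆[lsmul ℝ ℝ, volume] A.indicator (fun _ => (1 : ℝ))

lemma aestronglyMeasurable_indicator_one {A : Set (EuclideanSpace ℝ (Fin n))}
    (hA : NullMeasurableSet A) :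
    AEStronglyMeasurable (A.indicator (fun _ => (1 : ℝ))) volume :=
  aestronglyMeasurable_const.indicator₀ hA

lemma norm_indicator_one_le {X : Type*} (A : Set X) (x : X) :
    ‖A.indicator (fun _ => (1 : ℝ)) x‖ ≤ 1 := by
  by_cases hx : x ∈ A <;> simp [hx]

lemma locallyIntegrable_indicator_one {A : Set (EuclideanSpace ℝ (Fin n))}
    (hA : NullMeasurableSet A) : LocallyIntegrable (A.indicator (fun _ => (1 : ℝ))) :=
  (locallyIntegrable_const (1 : ℝ)).mono (aestronglyMeasurable_indicator_one hA)
    (.of_forall fun x => by simpa using norm_indicator_one_le A x)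

lemma contDiff_mollify (ρ : ContDiffBump (0 : EuclideanSpace ℝ (Fin n)))
    {A : Set (EuclideanSpace ℝ (Fin n))} (hA : NullMeasurableSet A) :
    ContDiff ℝ 1 (mollify ρ A) :=
  ρ.hasCompactSupport_normed.contDiff_convolution_left (n := 1) _ ρ.contDiff_normed
    (locallyIntegrable_indicator_one hA)

lemma mollify_nonneg (ρ : ContDiffBump (0 : EuclideanSpace ℝ (Fin n)))
    (A : Set (EuclideanSpace ℝ (Fin n))) (x : EuclideanSpace ℝ (Fin n)) : 0 ≤ mollify ρ A x :=
  integral_nonneg fun t => mul_nonneg (ρ.nonneg_normed t)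
    (Set.indicator_nonneg (fun _ _ => zero_le_one) _)

lemma mollify_le_one (ρ : ContDiffBump (0 : EuclideanSpace ℝ (Fin n)))
    (A : Set (EuclideanSpace ℝ (Fin n))) (x : EuclideanSpace ℝ (Fin n)) : mollify ρ A x ≤ 1 := by
  rw [← ρ.integral_normed (μ := volume)]
  refine integral_mono_of_nonneg (.of_forall fun t => mul_nonneg (ρ.nonneg_normed t)
    (Set.indicator_nonneg (fun _ _ => zero_le_one) _)) ρ.integrable_normed (.of_forall fun t => ?_)
  refine mul_le_of_le_one_right (ρ.nonneg_normed t) ?_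
  exact (le_abs_self _).trans (norm_indicator_one_le A _)

lemma setIntegral_eq_indicator_mul {A : Set (EuclideanSpace ℝ (Fin n))}
    (hA : NullMeasurableSet A) (f : EuclideanSpace ℝ (Fin n) → ℝ) :
    ∫ x in A, f x = ∫ x, A.indicator (fun _ => (1 : ℝ)) x * f x := by
  rw [← integral_indicator₀ hA]
  congr 1 with x
  by_cases hx : x ∈ A <;> simp [hx]

/-- Mollifying does not increase the total variation. -/
lemma integral_mollify_mul_divergence_le (ρ : ContDiffBump (0 : EuclideanSpace ℝ (Fin n)))
    {A : Set (EuclideanSpace ℝ (Fin n))} (hA : NullMeasurableSet A) (hper : perimeter A ≠ ⊤)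
    {φ : EuclideanSpace ℝ (Fin n) → EuclideanSpace ℝ (Fin n)} (hφ : IsTestField φ) :
    ∫ x, mollify ρ A x * divergence φ x ≤ (perimeter A).toReal := by
  have hdiv := integrable_divergence hφ.contDiff hφ.hasCompactSupport
  have hint : Integrable (fun p : EuclideanSpace ℝ (Fin n) × EuclideanSpace ℝ (Fin n) =>
      ρ.normed volume p.2 * A.indicator (fun _ => (1 : ℝ)) (p.1 - p.2) * divergence φ p.1)
      (volume.prod volume) := by
    refine (hdiv.norm.mul_prod (ρ.integrable_normed (μ := volume))).mono' ?_
      (.of_forall fun p => ?_)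
    · exact ((ρ.integrable_normed (μ := volume)).aestronglyMeasurable.convolution_integrand
        (lsmul ℝ ℝ) (aestronglyMeasurable_indicator_one hA)).mul
        hdiv.aestronglyMeasurable.comp_fst
    · rw [norm_mul, norm_mul, Real.norm_of_nonneg (ρ.nonneg_normed _)]
      have := norm_indicator_one_le A (p.1 - p.2)
      calc _ ≤ ρ.normed volume p.2 * 1 * ‖divergence φ p.1‖ := by
            gcongr
            exact ρ.nonneg_normed _
        _ = _ := by ring
  -- Translating the set by `t` amounts to translating the field by `t`, which gives another test
  -- field; the mollification is an average of such translates.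
  have hslice : ∀ t, ∫ x, ρ.normed volume t * A.indicator (fun _ => (1 : ℝ)) (x - t) *
      divergence φ x = ρ.normed volume t * ∫ x in A, divergence (fun y => φ (y + t)) x := by
    intro t
    rw [setIntegral_eq_indicator_mul hA, ← integral_const_mul, ← integral_add_right_eq_self _ t]
    congr 1 with x
    rw [divergence_comp_add, add_sub_cancel_right, mul_assoc]
  calc ∫ x, mollify ρ A x * divergence φ x
      = ∫ x, ∫ t, ρ.normed volume t * A.indicator (fun _ => (1 : ℝ)) (x - t) *
          divergence φ x := by
        congr 1 with x
        rw [integral_mul_const]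
        rfl
    _ = ∫ t, ∫ x, ρ.normed volume t * A.indicator (fun _ => (1 : ℝ)) (x - t) *
          divergence φ x := integral_integral_swap hint
    _ ≤ ∫ t, ρ.normed volume t * (perimeter A).toReal := by
        refine integral_mono hint.integral_prod_right
          ((ρ.integrable_normed (μ := volume)).mul_const _) fun t => ?_
        change ∫ x, ρ.normed volume t * A.indicator (fun _ => (1 : ℝ)) (x - t) *
          divergence φ x ≤ _
        rw [hslice]
        exact mul_le_mul_of_nonneg_left ((hφ.comp_add t).integral_le hper) (ρ.nonneg_normed t)
    _ = (perimeter A).toReal := by rw [integral_mul_const, ρ.integral_normed, one_mul]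

/-! ### Submodularity of the perimeter -/

lemma divergence_interpolate {φ ψ : EuclideanSpace ℝ (Fin n) → EuclideanSpace ℝ (Fin n)}
    (hφ : ContDiff ℝ 1 φ) (hψ : ContDiff ℝ 1 ψ) {χ : EuclideanSpace ℝ (Fin n) → ℝ}
    (hχ : ContDiff ℝ 1 χ) (x : EuclideanSpace ℝ (Fin n)) :
    divergence (fun y => χ y • φ y + (1 - χ y) • ψ y) x =
      χ x * divergence φ x + (1 - χ x) * divergence ψ x
        + fderiv ℝ χ x (φ x) - fderiv ℝ χ x (ψ x) := by
  have hχ' : ContDiff ℝ 1 fun y => 1 - χ y := contDiff_const.sub hχ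
  have h1 : ContDiff ℝ 1 fun y => χ y • φ y := hχ.smul hφ
  have h2 : ContDiff ℝ 1 fun y => (1 - χ y) • ψ y := hχ'.smul hψ
  rw [divergence_add h1 h2, divergence_smul hχ hφ, divergence_smul hχ' hψ,
    fderiv_const_sub]
  simp only [_root_.neg_apply]
  ring

/-- For smooth functions `u, v`, the products `u v` and `u + v - u v` replace the minimum and
maximum, and interpolated fields test `u` and `v`. -/
lemma integral_interpolate_eq {u v : EuclideanSpace ℝ (Fin n) → ℝ} (hu : ContDiff ℝ 1 u)
    (hv : ContDiff ℝ 1 v) {φ ψ : EuclideanSpace ℝ (Fin n) → EuclideanSpace ℝ (Fin n)}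
    (hφ : ContDiff ℝ 1 φ) (hφc : HasCompactSupport φ)
    (hψ : ContDiff ℝ 1 ψ) (hψc : HasCompactSupport ψ) :
    (∫ x, (u x * v x) * divergence φ x) + ∫ x, (u x + v x - u x * v x) * divergence ψ x =
      (∫ x, u x * divergence (fun y => v y • φ y + (1 - v y) • ψ y) x) +
        ∫ x, v x * divergence (fun y => u y • φ y + (1 - u y) • ψ y) x := by
  have hint : ∀ {w : EuclideanSpace ℝ (Fin n) → ℝ}
      {η : EuclideanSpace ℝ (Fin n) → EuclideanSpace ℝ (Fin n)}, ContDiff ℝ 1 w →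
      ContDiff ℝ 1 η → HasCompactSupport η → Integrable fun x => w x * divergence η x :=
    fun hw hη hηc => (hw.continuous.mul (continuous_divergence hη)).integrable_of_hasCompactSupport
      (hasCompactSupport_divergence hηc).mul_left
  have hcs : ∀ {w : EuclideanSpace ℝ (Fin n) → ℝ}
      {η : EuclideanSpace ℝ (Fin n) → EuclideanSpace ℝ (Fin n)}, HasCompactSupport η →
      HasCompactSupport fun x => w x • η x :=
    fun {w η} hη => HasCompactSupport.smul_left (f := w) hη
  have huv : ContDiff ℝ 1 fun x => u x * v x := hu.mul hv
  have hmix : ∀ {w : EuclideanSpace ℝ (Fin n) → ℝ}, ContDiff ℝ 1 w →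
      ContDiff ℝ 1 fun y => w y • φ y + (1 - w y) • ψ y := fun hw =>
    (hw.smul hφ).add ((contDiff_const.sub hw).smul hψ)
  have hmixc : ∀ {w : EuclideanSpace ℝ (Fin n) → ℝ},
      HasCompactSupport fun y => w y • φ y + (1 - w y) • ψ y := fun {w} =>
    (hcs (w := w) hφc).add (hcs (w := fun y => 1 - w y) hψc)
  have huvφ : ContDiff ℝ 1 fun x => (u x * v x) • φ x := huv.smul hφ
  have huvψ : ContDiff ℝ 1 fun x => (u x * v x) • ψ x := huv.smul hψ
  have hmax : ContDiff ℝ 1 fun x => u x + v x - u x * v x := (hu.add hv).sub huv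
  have hiφ := integrable_divergence huvφ (hcs hφc)
  have hiψ := integrable_divergence huvψ (hcs hψc)
  -- The integrands of the two sides differ exactly by the divergence of `u v (φ - ψ)`, a compactly
  -- supported field.
  have hsum : ∫ x, (divergence (fun y => (u y * v y) • φ y) x -
      divergence (fun y => (u y * v y) • ψ y) x) = 0 := by
    rw [integral_sub hiφ hiψ, integral_divergence huvφ (hcs hφc),
      integral_divergence huvψ (hcs hψc), sub_zero]
  have hi₁ : Integrable fun x => u x * v x * divergence φ x +
      (u x + v x - u x * v x) * divergence ψ x :=
    (hint huv hφ hφc).add (hint hmax hψ hψc)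
  have hi₂ : Integrable fun x => divergence (fun y => (u y * v y) • φ y) x -
      divergence (fun y => (u y * v y) • ψ y) x := hiφ.sub hiψ
  rw [← integral_add (hint huv hφ hφc) (hint hmax hψ hψc),
    ← integral_add (hint hu (hmix hv) hmixc) (hint hv (hmix hu) hmixc), ← add_zero (∫ x, _ + _),
    ← hsum, ← integral_add hi₁ hi₂]
  congr 1 with x
  rw [divergence_interpolate hφ hψ hv, divergence_interpolate hφ hψ hu,
    divergence_smul huv hφ, divergence_smul huv hψ,
    fderiv_fun_mul (hu.differentiable one_ne_zero x) (hv.differentiable one_ne_zero x)]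
  simp only [_root_.add_apply, _root_.smul_apply, smul_eq_mul]
  ring

/-- A sequence of mollifiers concentrating at the origin. -/
def shrinkingBump (n k : ℕ) : ContDiffBump (0 : EuclideanSpace ℝ (Fin n)) where
  rIn := 1 / ((k : ℝ) + 1)
  rOut := 2 * (1 / ((k : ℝ) + 1))
  rIn_pos := by positivity
  rIn_lt_rOut := by
    have : 0 < 1 / ((k : ℝ) + 1) := by positivity
    linarith

/-- Lebesgue differentiation: it requires the ratio of outer to inner radius to stay bounded, here
by `K = 2`. -/
lemma ae_tendsto_mollify {A : Set (EuclideanSpace ℝ (Fin n))} (hA : NullMeasurableSet A) :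
    ∀ᵐ x, Tendsto (fun k => mollify (shrinkingBump n k) A x) atTop
      (𝓝 (A.indicator (fun _ => (1 : ℝ)) x)) := by
  refine ContDiffBump.ae_convolution_tendsto_right_of_locallyIntegrable (K := 2) ?_
    (.of_forall fun k => le_rfl) (locallyIntegrable_indicator_one hA)
  simpa [shrinkingBump] using (tendsto_one_div_add_atTop_nhds_zero_nat (𝕜 := ℝ)).const_mul 2

lemma tendsto_integral_mul_divergence {w : ℕ → EuclideanSpace ℝ (Fin n) → ℝ}
    {w' : EuclideanSpace ℝ (Fin n) → ℝ}
    (hw : ∀ k, Continuous (w k)) (hb : ∀ k x, ‖w k x‖ ≤ 1)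
    (hlim : ∀ᵐ x, Tendsto (fun k => w k x) atTop (𝓝 (w' x)))
    {φ : EuclideanSpace ℝ (Fin n) → EuclideanSpace ℝ (Fin n)} (hφ : IsTestField φ) :
    Tendsto (fun k => ∫ x, w k x * divergence φ x) atTop (𝓝 (∫ x, w' x * divergence φ x)) := by
  have hdiv := integrable_divergence hφ.contDiff hφ.hasCompactSupport
  refine tendsto_integral_of_dominated_convergence (fun x => ‖divergence φ x‖)
    (fun k => (hw k).aestronglyMeasurable.mul hdiv.aestronglyMeasurable) hdiv.norm
    (fun k => .of_forall fun x => ?_) (hlim.mono fun x hx => hx.mul_const _)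
  rw [norm_mul]
  exact mul_le_of_le_one_left (norm_nonneg _) (hb k x)

/-- Apply the interpolation identity to the mollified indicators and let the mollifiers shrink.
Since `φ` and `ψ` are independent, the two suprema can afterwards be taken separately. -/
lemma integral_inter_add_integral_union_le {A B : Set (EuclideanSpace ℝ (Fin n))}
    (hA : NullMeasurableSet A) (hB : NullMeasurableSet B) (hAp : perimeter A ≠ ⊤)
    (hBp : perimeter B ≠ ⊤) {φ ψ : EuclideanSpace ℝ (Fin n) → EuclideanSpace ℝ (Fin n)}
    (hφ : IsTestField φ) (hψ : IsTestField ψ) :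
    (∫ x in A ∩ B, divergence φ x) + ∫ x in A ∪ B, divergence ψ x ≤
      (perimeter A).toReal + (perimeter B).toReal := by
  let u : ℕ → EuclideanSpace ℝ (Fin n) → ℝ := fun k => mollify (shrinkingBump n k) A
  let v : ℕ → EuclideanSpace ℝ (Fin n) → ℝ := fun k => mollify (shrinkingBump n k) B
  have hu : ∀ k, ContDiff ℝ 1 (u k) := fun k => contDiff_mollify _ hA
  have hv : ∀ k, ContDiff ℝ 1 (v k) := fun k => contDiff_mollify _ hB
  have hu0 : ∀ k x, 0 ≤ u k x := fun k => mollify_nonneg _ _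
  have hv0 : ∀ k x, 0 ≤ v k x := fun k => mollify_nonneg _ _
  have hu1 : ∀ k x, u k x ≤ 1 := fun k => mollify_le_one _ _
  have hv1 : ∀ k x, v k x ≤ 1 := fun k => mollify_le_one _ _
  have hinter : Tendsto (fun k => ∫ x, (u k x * v k x) * divergence φ x) atTop
      (𝓝 (∫ x in A ∩ B, divergence φ x)) := by
    rw [setIntegral_eq_indicator_mul (hA.inter hB)]
    refine tendsto_integral_mul_divergence (w := fun k x => u k x * v k x)
      (fun k => (hu k).continuous.mul (hv k).continuous) (fun k x => ?_) ?_ hφ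
    · rw [Real.norm_of_nonneg (mul_nonneg (hu0 k x) (hv0 k x))]
      exact mul_le_one₀ (hu1 k x) (hv0 k x) (hv1 k x)
    · filter_upwards [ae_tendsto_mollify hA, ae_tendsto_mollify hB] with x hxA hxB
      convert! hxA.mul hxB using 2
      by_cases h1 : x ∈ A <;> by_cases h2 : x ∈ B <;> simp [h1, h2]
  have hunion : Tendsto (fun k => ∫ x, (u k x + v k x - u k x * v k x) * divergence ψ x) atTop
      (𝓝 (∫ x in A ∪ B, divergence ψ x)) := by
    rw [setIntegral_eq_indicator_mul (hA.union hB)]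
    refine tendsto_integral_mul_divergence (w := fun k x => u k x + v k x - u k x * v k x)
      (fun k => ((hu k).continuous.add (hv k).continuous).sub
        ((hu k).continuous.mul (hv k).continuous)) (fun k x => ?_) ?_ hψ
    · rw [Real.norm_eq_abs, abs_le]
      constructor <;> nlinarith [hu0 k x, hv0 k x, hu1 k x, hv1 k x]
    · filter_upwards [ae_tendsto_mollify hA, ae_tendsto_mollify hB] with x hxA hxB
      convert! (hxA.add hxB).sub (hxA.mul hxB) using 2
      by_cases h1 : x ∈ A <;> by_cases h2 : x ∈ B <;> simp [h1, h2]
  refine le_of_tendsto' (hinter.add hunion) fun k => ?_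
  rw [integral_interpolate_eq (hu k) (hv k) hφ.contDiff hφ.hasCompactSupport hψ.contDiff
    hψ.hasCompactSupport]
  exact add_le_add
    (integral_mollify_mul_divergence_le _ hA hAp (hφ.interpolate hψ (hv k) (hv0 k) (hv1 k)))
    (integral_mollify_mul_divergence_le _ hB hBp (hφ.interpolate hψ (hu k) (hu0 k) (hu1 k)))

/-- The perimeter is submodular. -/
theorem perimeter_inter_add_perimeter_union_le {A B : Set (EuclideanSpace ℝ (Fin n))}
    (hA : NullMeasurableSet A) (hB : NullMeasurableSet B) :
    perimeter (A ∩ B) + perimeter (A ∪ B) ≤ perimeter A + perimeter B := by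
  by_cases hAp : perimeter A = ⊤
  · simp [hAp]
  by_cases hBp : perimeter B = ⊤
  · simp [hBp]
  have key := fun φ ψ (hφ : IsTestField φ) (hψ : IsTestField ψ) =>
    integral_inter_add_integral_union_le hA hB hAp hBp hφ hψ
  set c := (perimeter A).toReal + (perimeter B).toReal with hc
  have hc0 : 0 ≤ c := by positivity
  have hI : perimeter (A ∩ B) ≤ ENNReal.ofReal c :=
    (perimeter_le_iff hc0).2 fun φ hφ => by simpa using key φ _ hφ isTestField_zero
  have hIfin := (hI.trans_lt ENNReal.ofReal_lt_top).ne
  have hIc : (perimeter (A ∩ B)).toReal ≤ c := ENNReal.toReal_le_of_le_ofReal hc0 hI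
  -- For fixed `ψ`, take the supremum over `φ` first; this bounds the integral over the union by
  -- what the perimeter of the intersection leaves of `c`.
  have hU : perimeter (A ∪ B) ≤ ENNReal.ofReal (c - (perimeter (A ∩ B)).toReal) := by
    refine (perimeter_le_iff (sub_nonneg.2 hIc)).2 fun ψ hψ => ?_
    have h0 : 0 ≤ c - ∫ x in A ∪ B, divergence ψ x := by
      simpa using key _ ψ isTestField_zero hψ
    have := ENNReal.toReal_le_of_le_ofReal h0
      ((perimeter_le_iff (F := A ∩ B) h0).2 fun φ hφ => by linarith [key φ ψ hφ hψ])
    linarith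
  calc perimeter (A ∩ B) + perimeter (A ∪ B)
      ≤ ENNReal.ofReal (perimeter (A ∩ B)).toReal +
        ENNReal.ofReal (c - (perimeter (A ∩ B)).toReal) := by
        rw [ENNReal.ofReal_toReal hIfin]
        gcongr
    _ = ENNReal.ofReal c := by
        rw [← ENNReal.ofReal_add ENNReal.toReal_nonneg (sub_nonneg.2 hIc), add_sub_cancel]
    _ = perimeter A + perimeter B := by
        rw [hc, ENNReal.ofReal_add ENNReal.toReal_nonneg ENNReal.toReal_nonneg,
          ENNReal.ofReal_toReal hAp, ENNReal.ofReal_toReal hBp]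

/-! ### Perimeter near infinity and radial cutoffs -/

/-- A set of finite perimeter has small perimeter far away from the origin. -/
lemma exists_forall_integral_divergence_le {E : Set (EuclideanSpace ℝ (Fin n))}
    (hE : perimeter E ≠ ⊤) {ε : ℝ} (hε : 0 < ε) :
    ∃ R : ℝ, ∀ ψ, IsTestField ψ → (∀ x, ‖x‖ ≤ R → ψ x = 0) →
      ∫ x in E, divergence ψ x ≤ ε := by
  -- A field `φ` that is optimal up to `ε`. A field `ψ` living outside a ball containing its support
  -- can be added without violating the norm bound, so `ψ` can gain at most `ε`.
  obtain ⟨φ, hφ, hlt⟩ : ∃ φ, IsTestField φ ∧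
      (perimeter E).toReal - ε < ∫ x in E, divergence φ x := by
    by_contra! hcon
    have h0 : 0 ≤ (perimeter E).toReal - ε := by simpa using hcon _ isTestField_zero
    have := ENNReal.toReal_le_of_le_ofReal h0 ((perimeter_le_iff h0).2 hcon)
    linarith
  obtain ⟨R, hR⟩ := hφ.hasCompactSupport.isCompact.isBounded.subset_closedBall 0
  refine ⟨R, fun ψ hψ hψR => ?_⟩
  have hφ0 : ∀ x, ¬ ‖x‖ ≤ R → φ x = 0 := fun x hx => by
    by_contra hne
    exact hx (by simpa using hR (subset_tsupport φ hne))
  have hsum : IsTestField (fun x => φ x + ψ x) := by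
    refine ⟨hφ.contDiff.add hψ.contDiff, hφ.hasCompactSupport.add hψ.hasCompactSupport,
      fun x => ?_⟩
    by_cases hx : ‖x‖ ≤ R
    · simpa [hψR x hx] using hφ.norm_le x
    · simpa [hφ0 x hx] using hψ.norm_le x
  have := hsum.integral_le hE
  simp_rw [divergence_add hφ.contDiff hψ.contDiff] at this
  rw [integral_add (integrable_divergence hφ.contDiff hφ.hasCompactSupport).integrableOn
    (integrable_divergence hψ.contDiff hψ.hasCompactSupport).integrableOn] at this
  linarith

/-- These are points of global minimum or maximum, which covers the endpoints `0` and `1` too. -/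
lemma deriv_smoothTransition_eq_zero {t : ℝ} (ht : t ≤ 0 ∨ 1 ≤ t) :
    deriv Real.smoothTransition t = 0 := by
  rcases ht with ht | ht
  · refine IsLocalMin.deriv_eq_zero (.of_forall fun s => ?_)
    rw [Real.smoothTransition.zero_of_nonpos ht]
    exact Real.smoothTransition.nonneg s
  · refine IsLocalMax.deriv_eq_zero (.of_forall fun s => ?_)
    rw [Real.smoothTransition.one_of_one_le ht]
    exact Real.smoothTransition.le_one s

lemma exists_abs_deriv_smoothTransition_le :
    ∃ C : ℝ, 0 ≤ C ∧ ∀ t, |deriv Real.smoothTransition t| ≤ C := by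
  have hcont : Continuous (deriv Real.smoothTransition) :=
    (Real.smoothTransition.contDiff (n := 1)).continuous_deriv le_rfl
  obtain ⟨C, hC⟩ := isCompact_Icc.exists_bound_of_continuousOn
    (hcont.continuousOn (s := Set.Icc (0 : ℝ) 1))
  have hC0 : 0 ≤ C := (norm_nonneg _).trans (hC 0 (by simp))
  refine ⟨C, hC0, fun t => ?_⟩
  by_cases ht : t ∈ Set.Icc (0 : ℝ) 1
  · exact hC t ht
  · rw [deriv_smoothTransition_eq_zero, abs_zero]
    · exact hC0
    · simp only [Set.mem_Icc, not_and_or, not_le] at ht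
      exact ht.imp le_of_lt le_of_lt

/-- A smooth cutoff function passing from `1` to `0` where `τ ≤ ‖x‖ ^ 2 ≤ τ + δ`. -/
def cutoff (τ δ : ℝ) (x : EuclideanSpace ℝ (Fin n)) : ℝ :=
  Real.smoothTransition ((τ + δ - ‖x‖ ^ 2) / δ)

lemma contDiff_cutoff (τ δ : ℝ) :
    ContDiff ℝ 1 (cutoff τ δ : EuclideanSpace ℝ (Fin n) → ℝ) :=
  (Real.smoothTransition.contDiff (n := 1)).comp
    ((contDiff_const.sub (contDiff_norm_sq ℝ)).div_const δ)

lemma cutoff_nonneg (τ δ : ℝ) (x : EuclideanSpace ℝ (Fin n)) : 0 ≤ cutoff τ δ x :=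
  Real.smoothTransition.nonneg _

lemma cutoff_le_one (τ δ : ℝ) (x : EuclideanSpace ℝ (Fin n)) : cutoff τ δ x ≤ 1 :=
  Real.smoothTransition.le_one _

lemma cutoff_eq_one {τ δ : ℝ} (hδ : 0 < δ) {x : EuclideanSpace ℝ (Fin n)} (hx : ‖x‖ ^ 2 ≤ τ) :
    cutoff τ δ x = 1 :=
  Real.smoothTransition.one_of_one_le ((one_le_div hδ).2 (by linarith))

lemma cutoff_eq_zero {τ δ : ℝ} (hδ : 0 < δ) {x : EuclideanSpace ℝ (Fin n)}
    (hx : τ + δ ≤ ‖x‖ ^ 2) : cutoff τ δ x = 0 :=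
  Real.smoothTransition.zero_of_nonpos (div_nonpos_of_nonpos_of_nonneg (by linarith) hδ.le)

lemma fderiv_cutoff (τ δ : ℝ) (x : EuclideanSpace ℝ (Fin n)) :
    fderiv ℝ (cutoff τ δ) x =
      (deriv Real.smoothTransition ((τ + δ - ‖x‖ ^ 2) / δ) * (-2 / δ)) • innerSL ℝ x := by
  have h1 : HasFDerivAt (fun x : EuclideanSpace ℝ (Fin n) => (τ + δ - ‖x‖ ^ 2) / δ)
      ((-2 / δ) • innerSL ℝ x) x := by
    have := (((hasStrictFDerivAt_norm_sq x).hasFDerivAt.const_sub (τ + δ)).const_mul δ⁻¹)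
    convert! this using 1
    · ext y
      ring
    · ext y
      simp
      ring
  have h2 := ((Real.smoothTransition.contDiff (n := 1)).differentiable one_ne_zero
    ((τ + δ - ‖x‖ ^ 2) / δ)).hasDerivAt
  rw [mul_smul]
  exact (h2.comp_hasFDerivAt x h1).fderiv

lemma fderiv_cutoff_eq_zero {τ δ : ℝ} (hδ : 0 < δ) {x : EuclideanSpace ℝ (Fin n)}
    (hx : ‖x‖ ^ 2 ≤ τ ∨ τ + δ ≤ ‖x‖ ^ 2) : fderiv ℝ (cutoff τ δ) x = 0 := by
  rw [fderiv_cutoff, deriv_smoothTransition_eq_zero]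
  · simp
  · rcases hx with hx | hx
    · exact .inr ((one_le_div hδ).2 (by linarith))
    · exact .inl (div_nonpos_of_nonpos_of_nonneg (by linarith) hδ.le)

/-- The cutoff depends on `‖x‖ ^ 2`, whose gradient `2 x` has norm at most `2 r` where the cutoff
varies; this is the source of the factor `r`. -/
lemma abs_fderiv_cutoff_le {C : ℝ} (hC0 : 0 ≤ C)
    (hC : ∀ t, |deriv Real.smoothTransition t| ≤ C) {τ δ r : ℝ} (hδ : 0 < δ) (hr : 0 ≤ r)
    (hτ : τ + δ ≤ r ^ 2) (x : EuclideanSpace ℝ (Fin n)) {y : EuclideanSpace ℝ (Fin n)}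
    (hy : ‖y‖ ≤ 1) : |fderiv ℝ (cutoff τ δ) x y| ≤ 2 * C * r / δ := by
  by_cases hx : τ + δ ≤ ‖x‖ ^ 2
  · rw [fderiv_cutoff_eq_zero hδ (.inr hx), _root_.zero_apply, abs_zero]
    positivity
  · have hxr : ‖x‖ ≤ r := le_of_sq_le_sq (by linarith) hr
    rw [fderiv_cutoff, _root_.smul_apply, smul_eq_mul, innerSL_apply_apply, abs_mul, abs_mul,
      abs_div, abs_of_pos hδ, abs_neg, abs_two]
    have hin : |inner ℝ x y| ≤ r * 1 :=
      (abs_real_inner_le_norm x y).trans (mul_le_mul hxr hy (norm_nonneg _) hr)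
    calc _ ≤ C * (2 / δ) * (r * 1) := by
          gcongr
          exact hC _
      _ = _ := by ring

/-! ### Volume within balls and the choice of a good radius -/

/-- The volume of the part of `D` in the ball of squared radius `τ`. -/
def volumeWithin (D : Set (EuclideanSpace ℝ (Fin n))) (τ : ℝ) : ℝ :=
  volume.real (D ∩ {x | ‖x‖ ^ 2 ≤ τ})

lemma measurableSet_norm_sq_le (τ : ℝ) :
    MeasurableSet {x : EuclideanSpace ℝ (Fin n) | ‖x‖ ^ 2 ≤ τ} :=
  measurableSet_le (by fun_prop) measurable_const

lemma monotone_volumeWithin {D : Set (EuclideanSpace ℝ (Fin n))} (hD : volume D < ⊤) :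
    Monotone (volumeWithin D) := fun s _ hst =>
  measureReal_mono (Set.inter_subset_inter_right _ fun x (hx : ‖x‖ ^ 2 ≤ s) => hx.trans hst)
    ((measure_mono Set.inter_subset_left).trans_lt hD).ne

lemma measureReal_annulus_eq {D : Set (EuclideanSpace ℝ (Fin n))} (hD : volume D < ⊤)
    {s t : ℝ} (hst : s ≤ t) :
    volume.real (D ∩ {x | s < ‖x‖ ^ 2 ∧ ‖x‖ ^ 2 ≤ t}) =
      volumeWithin D t - volumeWithin D s := by
  have hfin : ∀ {S : Set (EuclideanSpace ℝ (Fin n))}, volume (D ∩ S) ≠ ⊤ :=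
    ((measure_mono Set.inter_subset_left).trans_lt hD).ne
  have h := measureReal_inter_add_sdiff (μ := volume) (s := D ∩ {x | ‖x‖ ^ 2 ≤ t})
    (measurableSet_norm_sq_le s) hfin
  have h1 : D ∩ {x | ‖x‖ ^ 2 ≤ t} ∩ {x | ‖x‖ ^ 2 ≤ s} = D ∩ {x | ‖x‖ ^ 2 ≤ s} := by
    ext x
    simp only [Set.mem_inter_iff, Set.mem_ofPred_eq]
    exact ⟨fun h => ⟨h.1.1, h.2⟩, fun h => ⟨⟨h.1, h.2.trans hst⟩, h.2⟩⟩
  have h2 : (D ∩ {x | ‖x‖ ^ 2 ≤ t}) \ {x | ‖x‖ ^ 2 ≤ s} =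
      D ∩ {x | s < ‖x‖ ^ 2 ∧ ‖x‖ ^ 2 ≤ t} := by
    ext x
    simp only [Set.mem_inter_iff, Set.mem_sdiff, Set.mem_ofPred_eq, not_le]
    tauto
  rw [h1, h2] at h
  unfold volumeWithin
  linarith

/-- A monotone function has a point of differentiability where the derivative is at most
any number exceeding its average slope. -/
lemma exists_hasDerivAt_le_of_monotone {m : ℝ → ℝ} (hm : Monotone m) {a b c : ℝ} (hab : a < b)
    (hc : m b - m a < c * (b - a)) :
    ∃ τ ∈ Set.Icc a b, ∃ m', HasDerivAt m m' τ ∧ m' ≤ c := by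
  by_contra! hcon
  have hint : IntervalIntegrable (deriv m) volume a b :=
    (hm.monotoneOn _).intervalIntegrable_deriv
  -- Only an inequality, since a monotone function may have jumps or a singular part.
  have hle : ∫ x in a..b, deriv m x ≤ m b - m a := by
    have := (hm.monotoneOn (Set.uIcc a b)).intervalIntegral_deriv_mem_uIcc
    rw [Set.uIcc_of_le (sub_nonneg.2 (hm hab.le))] at this
    exact this.2
  have hge : ∫ _ in a..b, c ≤ ∫ x in a..b, deriv m x := by
    refine intervalIntegral.integral_mono_ae_restrict hab.le (by simp) hint ?_
    rw [EventuallyLE, ae_restrict_iff' measurableSet_Icc]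
    filter_upwards [hm.ae_differentiableAt] with x hx hxab
    exact (hcon x hxab _ hx.hasDerivAt).le
  rw [intervalIntegral.integral_const, smul_eq_mul] at hge
  linarith

/-! ### Truncating the excess of a superset -/

lemma tendsto_integral_cutoff_mul {D : Set (EuclideanSpace ℝ (Fin n))} (τ : ℝ)
    {φ : EuclideanSpace ℝ (Fin n) → EuclideanSpace ℝ (Fin n)} (hφ : IsTestField φ) :
    Tendsto (fun k : ℕ => ∫ x in D, cutoff τ (1 / ((k : ℝ) + 1)) x * divergence φ x) atTop
      (𝓝 (∫ x in D ∩ {x | ‖x‖ ^ 2 ≤ τ}, divergence φ x)) := by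
  have hdiv := (integrable_divergence hφ.contDiff hφ.hasCompactSupport).integrableOn (s := D)
  have hpos : ∀ k : ℕ, 0 < 1 / ((k : ℝ) + 1) := fun k => by positivity
  rw [Set.inter_comm, ← Measure.restrict_restrict (measurableSet_norm_sq_le τ),
    ← integral_indicator (measurableSet_norm_sq_le τ)]
  refine tendsto_integral_of_dominated_convergence (fun x => ‖divergence φ x‖)
    (fun k => (contDiff_cutoff τ _).continuous.aestronglyMeasurable.mul hdiv.aestronglyMeasurable)
    hdiv.norm (fun k => .of_forall fun x => ?_) (.of_forall fun x => ?_)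
  · rw [norm_mul, Real.norm_of_nonneg (cutoff_nonneg _ _ _)]
    exact mul_le_of_le_one_left (norm_nonneg _) (cutoff_le_one _ _ _)
  · by_cases hx : ‖x‖ ^ 2 ≤ τ
    · rw [Set.indicator_of_mem (show x ∈ {x | ‖x‖ ^ 2 ≤ τ} from hx)]
      simp only [cutoff_eq_one (hpos _) hx, one_mul]
      exact tendsto_const_nhds
    · rw [Set.indicator_of_notMem (show x ∉ {x | ‖x‖ ^ 2 ≤ τ} from hx)]
      refine tendsto_const_nhds.congr' ?_
      have hgap : 0 < ‖x‖ ^ 2 - τ := by linarith [not_le.1 hx]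
      filter_upwards [(tendsto_one_div_add_atTop_nhds_zero_nat (𝕜 := ℝ)).eventually_lt_const hgap]
        with k hk
      rw [cutoff_eq_zero (hpos k) (by linarith), zero_mul]

/-- The gradient of the cutoff lives on a thin annulus, so the error is controlled by a difference
quotient of `volumeWithin D`, which tends to a derivative as `δ → 0`. -/
lemma abs_setIntegral_fderiv_cutoff_le {C : ℝ} (hC0 : 0 ≤ C)
    (hC : ∀ t, |deriv Real.smoothTransition t| ≤ C) {τ δ r : ℝ} (hδ : 0 < δ) (hr : 0 ≤ r)
    (hτ : τ + δ ≤ r ^ 2) {D : Set (EuclideanSpace ℝ (Fin n))} (hD : volume D < ⊤)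
    {φ : EuclideanSpace ℝ (Fin n) → EuclideanSpace ℝ (Fin n)} (hφ : IsTestField φ) :
    |∫ x in D, fderiv ℝ (cutoff τ δ) x (φ x)| ≤
      2 * C * r * (δ⁻¹ * (volumeWithin D (τ + δ) - volumeWithin D τ)) := by
  set S : Set (EuclideanSpace ℝ (Fin n)) := {x | τ < ‖x‖ ^ 2 ∧ ‖x‖ ^ 2 ≤ τ + δ} with hSdef
  have hS : MeasurableSet S :=
    (measurableSet_norm_sq_le τ).compl.inter (measurableSet_norm_sq_le (τ + δ)) |>.congr (by
      ext x
      simp [hSdef])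
  have hind : (fun x => fderiv ℝ (cutoff τ δ) x (φ x)) =
      S.indicator fun x => fderiv ℝ (cutoff τ δ) x (φ x) := by
    ext x
    by_cases hx : x ∈ S
    · rw [Set.indicator_of_mem hx]
    · rw [Set.indicator_of_notMem hx, fderiv_cutoff_eq_zero hδ, _root_.zero_apply]
      simp only [hSdef, Set.mem_ofPred_eq, not_and_or, not_lt, not_le] at hx
      exact hx.imp id le_of_lt
  rw [hind, integral_indicator hS, Measure.restrict_restrict hS, Set.inter_comm,
    ← measureReal_annulus_eq hD (by linarith)]
  have hfin : volume (D ∩ S) < ⊤ := (measure_mono Set.inter_subset_left).trans_lt hD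
  refine (norm_setIntegral_le_of_norm_le_const
    (f := fun x => fderiv ℝ (cutoff τ δ) x (φ x)) (C := 2 * C * r / δ) hfin fun x _ =>
    abs_fderiv_cutoff_le hC0 hC hδ hr hτ x (hφ.norm_le x)).trans_eq ?_
  ring

/-- With a cutoff `χ`, split `φ = (1 - χ) φ + χ φ` on `E` and write `χ div φ = div (χ φ) - ∇χ · φ`
on `G \ E`. The two `χ φ` terms combine into a test of `G`, the field `(1 - χ) φ` vanishes in the
ball and costs at most `t`, and the gradient term becomes the `m'` term as `δ → 0`. -/
lemma integral_truncation_le {C : ℝ} (hC0 : 0 ≤ C)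
    (hC : ∀ t, |deriv Real.smoothTransition t| ≤ C) {E G : Set (EuclideanSpace ℝ (Fin n))}
    (hE : NullMeasurableSet E) (hG : NullMeasurableSet G) (hEG : E ⊆ G)
    (hvol : volume (G \ E) < ⊤) (hper : perimeter G ≠ ⊤) {τ r t m' : ℝ} (hr : 0 ≤ r)
    (hτ : τ + 1 ≤ r ^ 2)
    (ht : ∀ ψ, IsTestField ψ → (∀ x, ‖x‖ ^ 2 ≤ τ → ψ x = 0) → ∫ x in E, divergence ψ x ≤ t)
    (hm : HasDerivAt (volumeWithin (G \ E)) m' τ)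
    {φ : EuclideanSpace ℝ (Fin n) → EuclideanSpace ℝ (Fin n)} (hφ : IsTestField φ) :
    ∫ x in E ∪ ((G \ E) ∩ {x | ‖x‖ ^ 2 ≤ τ}), divergence φ x ≤
      t + (perimeter G).toReal + 2 * C * r * m' := by
  have hD : NullMeasurableSet (G \ E) := hG.diff hE
  have hdiv := integrable_divergence hφ.contDiff hφ.hasCompactSupport
  rw [setIntegral_union₀ (Set.disjoint_sdiff_right.mono_right Set.inter_subset_left).aedisjoint
    (hD.inter (measurableSet_norm_sq_le τ).nullMeasurableSet) hdiv.integrableOn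
    hdiv.integrableOn]
  set δ : ℕ → ℝ := fun k => 1 / ((k : ℝ) + 1) with hδdef
  have hδ : ∀ k, 0 < δ k := fun k => by simp only [hδdef]; positivity
  have hδ1 : ∀ k, δ k ≤ 1 := fun k => by
    simp only [hδdef]
    rw [div_le_one (by positivity)]
    simp
  have hslope : Tendsto (fun k => (δ k)⁻¹ *
      (volumeWithin (G \ E) (τ + δ k) - volumeWithin (G \ E) τ)) atTop (𝓝 m') :=
    hm.tendsto_slope_zero.comp (tendsto_nhdsWithin_iff.2
      ⟨tendsto_one_div_add_atTop_nhds_zero_nat, .of_forall fun k => (hδ k).ne'⟩)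
  refine le_of_tendsto_of_tendsto' ((tendsto_integral_cutoff_mul τ hφ).const_add _)
    ((hslope.const_mul (2 * C * r)).const_add _) fun k => ?_
  have hχ := contDiff_cutoff (n := n) τ (δ k)
  have hχ' : ContDiff ℝ 1 fun x : EuclideanSpace ℝ (Fin n) => 1 - cutoff τ (δ k) x :=
    contDiff_const.sub hχ
  have htest := hφ.smul hχ (cutoff_nonneg τ (δ k)) (cutoff_le_one τ (δ k))
  have htest' := hφ.smul hχ' (fun x => sub_nonneg.2 (cutoff_le_one τ (δ k) x))
    (fun x => sub_le_self _ (cutoff_nonneg τ (δ k) x))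
  have hi := integrable_divergence htest.contDiff htest.hasCompactSupport
  have hi' := integrable_divergence htest'.contDiff htest'.hasCompactSupport
  have hEint : ∫ x in E, divergence φ x =
      (∫ x in E, divergence (fun y => (1 - cutoff τ (δ k) y) • φ y) x) +
        ∫ x in E, divergence (fun y => cutoff τ (δ k) y • φ y) x := by
    rw [← integral_add hi'.integrableOn hi.integrableOn]
    congr 1 with x
    rw [← divergence_add htest'.contDiff htest.contDiff]
    congr 1 with y : 1
    rw [← add_smul, sub_add_cancel, one_smul]
  have hfint : Integrable fun x => fderiv ℝ (cutoff τ (δ k)) x (φ x) := by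
    have hcont := hχ.continuous_fderiv one_ne_zero
    refine (hcont.clm_apply hφ.contDiff.continuous).integrable_of_hasCompactSupport ?_
    refine hφ.hasCompactSupport.mono fun x hx => ?_
    contrapose! hx
    simp only [Function.mem_support, not_not] at hx ⊢
    rw [hx, map_zero]
  have hDint : ∫ x in G \ E, cutoff τ (δ k) x * divergence φ x =
      (∫ x in G \ E, divergence (fun y => cutoff τ (δ k) y • φ y) x) -
        ∫ x in G \ E, fderiv ℝ (cutoff τ (δ k)) x (φ x) := by
    rw [← integral_sub hi.integrableOn hfint.integrableOn]
    congr 1 with x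
    rw [divergence_smul hχ hφ.contDiff, add_sub_cancel_right]
  have hGint : (∫ x in E, divergence (fun y => cutoff τ (δ k) y • φ y) x) +
      ∫ x in G \ E, divergence (fun y => cutoff τ (δ k) y • φ y) x =
        ∫ x in G, divergence (fun y => cutoff τ (δ k) y • φ y) x := by
    rw [← setIntegral_union₀ Set.disjoint_sdiff_right.aedisjoint hD hi.integrableOn
      hi.integrableOn, Set.union_sdiff_cancel hEG]
  have h1 := ht _ htest' fun x hx => by rw [cutoff_eq_one (hδ k) hx, sub_self, zero_smul]
  have h2 := htest.integral_le hper
  have h3 := abs_le.1 (abs_setIntegral_fderiv_cutoff_le (τ := τ) hC0 hC (hδ k) hr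
    (by linarith [hδ1 k]) hvol hφ)
  change (∫ x in E, divergence φ x) + ∫ x in G \ E, cutoff τ (δ k) x * divergence φ x ≤ _
  linarith [h3.1]

/-- A minimizing hull of finite perimeter minimizes the perimeter among all supersets exceeding it
by a set of finite volume. -/
theorem IsMinimizingHull.perimeter_le_of_volume_lt_top {E G : Set (EuclideanSpace ℝ (Fin n))}
    (hE : IsMinimizingHull E) (hper : perimeter E < ⊤) (hG : NullMeasurableSet G) (hEG : E ⊆ G)
    (hvol : volume (G \ E) < ⊤) : perimeter E ≤ perimeter G := by
  by_cases hGp : perimeter G = ⊤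
  · simp [hGp]
  have hEm : NullMeasurableSet E := nullMeasurableSet_of_null_frontier hE.frontier_null
  obtain ⟨C, hC0, hC⟩ := exists_abs_deriv_smoothTransition_le
  rw [← ENNReal.toReal_le_toReal hper.ne hGp]
  refine le_of_forall_pos_le_add fun ε hε => ?_
  obtain ⟨R, hR⟩ := exists_forall_integral_divergence_le hper.ne (half_pos hε)
  set M := volume.real (G \ E)
  have hM : 0 ≤ M := measureReal_nonneg
  -- The last condition is the cutting error `2 C r m'` for `r = 3 b` and `m' ≤ (M + 1) / (3 b ^
  -- 2)`: the slope decays like `b⁻²`, the gradient factor grows only like `b`.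
  obtain ⟨b, hb1, hbR, hbε⟩ : ∃ b : ℝ, 1 ≤ b ∧ R ≤ b ∧ 2 * C * (M + 1) / b ≤ ε / 2 := by
    obtain ⟨b, hb⟩ := (((tendsto_id.const_div_atTop (2 * C * (M + 1))).eventually_le_const
      (half_pos hε)).and ((eventually_ge_atTop 1).and (eventually_ge_atTop R))).exists
    exact ⟨b, hb.2.1, hb.2.2, hb.1⟩
  have hb0 : 0 < b := by linarith
  have hmono := monotone_volumeWithin hvol
  -- Squared radii range over an interval of length `3 b ^ 2`; `M + 1` in place of `M` makes the
  -- slope bound strict.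
  obtain ⟨τ, ⟨hτ1, hτ2⟩, m', hm', hm'le⟩ := exists_hasDerivAt_le_of_monotone
    (c := (M + 1) / (3 * b ^ 2)) hmono (show b ^ 2 < 4 * b ^ 2 by nlinarith) (by
      have h1 : volumeWithin (G \ E) (4 * b ^ 2) ≤ M :=
        measureReal_mono Set.inter_subset_left hvol.ne
      have h2 : 0 ≤ volumeWithin (G \ E) (b ^ 2) := measureReal_nonneg
      have h3 : (M + 1) / (3 * b ^ 2) * (4 * b ^ 2 - b ^ 2) = M + 1 := by
        field_simp
        ring
      linarith)
  set H := E ∪ ((G \ E) ∩ {x | ‖x‖ ^ 2 ≤ τ}) with hHdef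
  have hbound : ∀ φ, IsTestField φ → ∫ x in H, divergence φ x ≤ (perimeter G).toReal + ε := by
    intro φ hφ
    have := integral_truncation_le hC0 hC hEm hG hEG hvol hGp (r := 3 * b) (t := ε / 2)
      (by positivity) (by nlinarith) (fun ψ hψ hψ0 => hR ψ hψ fun x hx => hψ0 x
        ((pow_le_pow_left₀ (norm_nonneg x) (hx.trans hbR) 2).trans hτ1)) hm' hφ
    have herr : 2 * C * (3 * b) * m' ≤ ε / 2 := by
      calc 2 * C * (3 * b) * m' ≤ 2 * C * (3 * b) * ((M + 1) / (3 * b ^ 2)) := by gcongr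
        _ = 2 * C * (M + 1) / b := by field_simp
        _ ≤ ε / 2 := hbε
    linarith
  have hHm : NullMeasurableSet H :=
    hEm.union ((hG.diff hEm).inter (measurableSet_norm_sq_le τ).nullMeasurableSet)
  have hHb : Bornology.IsBounded (H \ E) := by
    refine (Metric.isBounded_closedBall (x := (0 : EuclideanSpace ℝ (Fin n)))
      (r := 2 * b)).subset fun x hx => ?_
    rcases hx with ⟨hx | ⟨_, hx⟩, hxE⟩
    · exact absurd hx hxE
    · rw [mem_closedBall_zero_iff]
      refine le_of_sq_le_sq ?_ (by positivity)
      have : ‖x‖ ^ 2 ≤ τ := hx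
      linarith
  have h0 : 0 ≤ (perimeter G).toReal + ε := by positivity
  exact ENNReal.toReal_le_of_le_ofReal h0
    ((hE.perimeter_le H hHm Set.subset_union_left hHb).trans ((perimeter_le_iff h0).2 hbound))

/-! ### The weighted measure and comparison of minimizers -/

/-- The measure with density the distance to `∂E`. -/
def distMeasure (E : Set (EuclideanSpace ℝ (Fin n))) : Measure (EuclideanSpace ℝ (Fin n)) :=
  volume.withDensity fun x => Metric.infEDist x (frontier E)

lemma distMeasure_absolutelyContinuous (E : Set (EuclideanSpace ℝ (Fin n))) :
    distMeasure E ≪ volume :=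
  withDensity_absolutelyContinuous _ _

lemma energy_eq (h : ℝ) (E F : Set (EuclideanSpace ℝ (Fin n))) :
    energy h E F = perimeter F + ENNReal.ofReal (1 / h) * distMeasure E (symmDiff F E) := by
  rw [energy, distMeasure, withDensity_apply']

lemma energy_self (h : ℝ) (E : Set (EuclideanSpace ℝ (Fin n))) :
    energy h E E = perimeter E := by
  simp [energy]

/-- The density vanishes only on the closed set `∂E`, which is null. -/
lemma volume_eq_zero_of_distMeasure_eq_zero {E S : Set (EuclideanSpace ℝ (Fin n))}
    (hE : volume (frontier E) = 0) (hS : NullMeasurableSet S) (h : distMeasure E S = 0) :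
    volume S = 0 := by
  rw [distMeasure, withDensity_apply', lintegral_eq_zero_iff Metric.continuous_infEDist.measurable,
    EventuallyEq, ae_restrict_iff'₀ hS] at h
  refine measure_mono_null_ae ?_ hE
  filter_upwards [h] with x hx hxS
  exact (Metric.mem_iff_infEDist_zero_of_closed isClosed_frontier).2 (hx hxS)

lemma IsStepMinimizer.energy_lt_top {h : ℝ} {Ω E F : Set (EuclideanSpace ℝ (Fin n))}
    (hF : IsStepMinimizer h Ω E F) (hE : IsMinimizingHull E) (hper : perimeter E < ⊤)
    (hΩ : Ω ⊆ E) : energy h E F < ⊤ := by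
  refine (hF.energy_le E ⟨nullMeasurableSet_of_null_frontier hE.frontier_null, hΩ, ?_⟩).trans_lt ?_
  · simp
  · rwa [energy_self]

/-- Minimizers do not leave a minimizing hull. -/
lemma IsStepMinimizer.volume_diff_eq_zero {h : ℝ} {Ω E F : Set (EuclideanSpace ℝ (Fin n))}
    (hF : IsStepMinimizer h Ω E F) (hh : 0 < h) (hE : IsMinimizingHull E)
    (hper : perimeter E < ⊤) (hΩ : Ω ⊆ E) : volume (F \ E) = 0 := by
  have hEm : NullMeasurableSet E := nullMeasurableSet_of_null_frontier hE.frontier_null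
  have hFm := hF.admissible.measurable
  have hfin := hF.energy_lt_top hE hper hΩ
  -- The hull property applies to `F ∪ E`, whose excess over `E` has finite volume by admissibility;
  -- submodularity transfers the gain to `F ∩ E`.
  have hinter : perimeter (F ∩ E) ≤ perimeter F := by
    have h1 := perimeter_inter_add_perimeter_union_le hFm hEm
    have h2 := hE.perimeter_le_of_volume_lt_top hper (hFm.union hEm) Set.subset_union_right
      (by simpa [Set.union_sdiff_right] using hF.admissible.finite_excess)
    exact (ENNReal.add_le_add_iff_right hper.ne).1 ((add_le_add_right h2 _).trans h1)
  have hle := hF.energy_le (F ∩ E) ⟨hFm.inter hEm,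
    Set.subset_inter hF.admissible.obstacle_subset hΩ, by simp [Set.inter_sdiff_assoc]⟩
  have hc : ENNReal.ofReal (1 / h) ≠ 0 := by simpa using hh
  have hsymm : symmDiff (F ∩ E) E = E \ F := by
    ext x
    simp only [Set.mem_symmDiff, Set.mem_inter_iff, Set.mem_sdiff]
    tauto
  have hsplit : distMeasure E (symmDiff F E) = distMeasure E (F \ E) + distMeasure E (E \ F) := by
    rw [Set.symmDiff_def]
    exact measure_union₀ ((hEm.diff hFm).mono_ac (distMeasure_absolutelyContinuous E))
      disjoint_sdiff_sdiff.aedisjoint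
  rw [energy_eq] at hfin
  rw [energy_eq, energy_eq, hsymm, hsplit] at hle
  rw [hsplit, mul_add] at hfin
  rw [mul_add] at hle
  have hne : perimeter F + ENNReal.ofReal (1 / h) * distMeasure E (E \ F) ≠ ⊤ := by
    refine (lt_of_le_of_lt ?_ hfin).ne
    gcongr
    exact le_add_self
  -- Replacing `F` by `F ∩ E` saves the whole penalty on `F \ E` without raising the perimeter, so
  -- minimality forces this penalty to vanish.
  have hzero : ENNReal.ofReal (1 / h) * distMeasure E (F \ E) ≤ 0 := by
    rw [← ENNReal.add_le_add_iff_left hne, add_zero]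
    calc _ = perimeter F + (ENNReal.ofReal (1 / h) * distMeasure E (F \ E) +
          ENNReal.ofReal (1 / h) * distMeasure E (E \ F)) := by ring
      _ ≤ _ := hle
      _ ≤ _ := by gcongr
  refine volume_eq_zero_of_distMeasure_eq_zero hE.frontier_null (hFm.diff hEm) ?_
  exact (mul_eq_zero.1 (nonpos_iff_eq_zero.1 hzero)).resolve_left hc

lemma distMeasure_symmDiff_eq {E S : Set (EuclideanSpace ℝ (Fin n))} (hS : volume (S \ E) = 0) :
    distMeasure E (symmDiff S E) = distMeasure E (E \ S) := by
  rw [Set.symmDiff_def]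
  exact le_antisymm ((measure_union_le _ _).trans_eq
    (by rw [distMeasure_absolutelyContinuous E hS, zero_add])) (measure_mono Set.subset_union_right)

/-- As `S` lies in `E` almost everywhere, passing from `S` to the smaller `T` enlarges the missing
part by `S \ T`. -/
lemma distMeasure_diff_eq_add {E S T : Set (EuclideanSpace ℝ (Fin n))}
    (hS : NullMeasurableSet S) (hT : NullMeasurableSet T)
    (hTS : T ⊆ S) (hSE : volume (S \ E) = 0) :
    distMeasure E (E \ T) = distMeasure E (E \ S) + distMeasure E (S \ T) := by
  have hac := distMeasure_absolutelyContinuous E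
  rw [← measure_union₀ ((hS.diff hT).mono_ac hac)
    (Set.disjoint_left.2 fun x hx hx' => hx.2 hx'.1).aedisjoint]
  refine le_antisymm (measure_mono fun x hx => ?_) (measure_mono_ae (hac.ae_le ?_))
  · by_cases hxS : x ∈ S
    · exact .inr ⟨hxS, hx.2⟩
    · exact .inl ⟨hx.1, hxS⟩
  · filter_upwards [measure_eq_zero_iff_ae_notMem.1 hSE] with x hx hxu
    rcases hxu with h | h
    · exact ⟨h.1, fun hxT => h.2 (hTS hxT)⟩
    · exact ⟨by_contra fun hxE => hx ⟨h.1, hxE⟩, h.2⟩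

/-- Minimizers for a larger step size are contained in minimizers for a smaller one. -/
theorem IsStepMinimizer.volume_diff_eq_zero_of_lt {h h' : ℝ}
    {Ω E F F' : Set (EuclideanSpace ℝ (Fin n))} (hF : IsStepMinimizer h Ω E F)
    (hF' : IsStepMinimizer h' Ω E F') (hpos : 0 < h') (hlt : h' < h) (hE : IsMinimizingHull E)
    (hper : perimeter E < ⊤) (hΩ : Ω ⊆ E) : volume (F \ F') = 0 := by
  have hEm : NullMeasurableSet E := nullMeasurableSet_of_null_frontier hE.frontier_null
  have hFm := hF.admissible.measurable
  have hFm' := hF'.admissible.measurable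
  have hFE := hF.volume_diff_eq_zero (hpos.trans hlt) hE hper hΩ
  have hFE' := hF'.volume_diff_eq_zero hpos hE hper hΩ
  have hIE : volume ((F ∩ F') \ E) = 0 :=
    measure_mono_null (Set.sdiff_subset_sdiff_left Set.inter_subset_left) hFE
  have hUE : volume ((F ∪ F') \ E) = 0 := by
    rw [Set.union_sdiff_distrib]
    exact measure_union_null hFE hFE'
  have hle := hF.energy_le (F ∩ F') ⟨hFm.inter hFm',
    Set.subset_inter hF.admissible.obstacle_subset hF'.admissible.obstacle_subset, by simp [hIE]⟩
  have hle' := hF'.energy_le (F ∪ F') ⟨hFm.union hFm',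
    hF'.admissible.obstacle_subset.trans Set.subset_union_right, by simp [hUE]⟩
  have hfin := hF.energy_lt_top hE hper hΩ
  have hfin' := hF'.energy_lt_top hE hper hΩ
  have hsub := perimeter_inter_add_perimeter_union_le hFm hFm'
  rw [energy_eq, distMeasure_symmDiff_eq hFE] at hfin
  rw [energy_eq, energy_eq, distMeasure_symmDiff_eq hFE, distMeasure_symmDiff_eq hIE,
    distMeasure_diff_eq_add hFm (hFm.inter hFm') Set.inter_subset_left hFE,
    Set.sdiff_self_inter, mul_add] at hle
  have hsplit' := distMeasure_diff_eq_add (hFm.union hFm') hFm' Set.subset_union_right hUE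
  rw [Set.union_sdiff_right] at hsplit'
  rw [energy_eq, distMeasure_symmDiff_eq hFE', hsplit', mul_add] at hfin'
  rw [energy_eq, energy_eq, distMeasure_symmDiff_eq hFE', distMeasure_symmDiff_eq hUE,
    hsplit', mul_add] at hle'
  set c := ENNReal.ofReal (1 / h)
  set c' := ENNReal.ofReal (1 / h')
  set I := distMeasure E (F \ F')
  set V := distMeasure E (E \ F)
  set W := distMeasure E (E \ (F ∪ F'))
  obtain ⟨hPF, hV⟩ := ENNReal.add_lt_top.1 hfin
  obtain ⟨hPF', hWI⟩ := ENNReal.add_lt_top.1 hfin'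
  obtain ⟨hW, hI⟩ := ENNReal.add_lt_top.1 hWI
  have h1 : perimeter F ≤ perimeter (F ∩ F') + c * I := by
    rw [← ENNReal.add_le_add_iff_left hV.ne]
    calc c * V + perimeter F = perimeter F + c * V := add_comm _ _
      _ ≤ _ := hle
      _ = _ := by ring
  have h2 : perimeter F' + c' * I ≤ perimeter (F ∪ F') := by
    rw [← ENNReal.add_le_add_iff_left hW.ne]
    calc c' * W + (perimeter F' + c' * I) = perimeter F' + (c' * W + c' * I) := by ring
      _ ≤ _ := hle'
      _ = _ := by ring
  -- Sum of the two comparisons; submodularity lets the finite perimeters cancel.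
  have h3 : c' * I ≤ c * I := by
    rw [← ENNReal.add_le_add_iff_left (ENNReal.add_lt_top.2 ⟨hPF, hPF'⟩).ne]
    calc perimeter F + perimeter F' + c' * I = perimeter F + (perimeter F' + c' * I) := by ring
      _ ≤ perimeter (F ∩ F') + c * I + perimeter (F ∪ F') := add_le_add h1 h2
      _ = perimeter (F ∩ F') + perimeter (F ∪ F') + c * I := by ring
      _ ≤ _ := by gcongr
  have hcc : c < c' := by
    refine (ENNReal.ofReal_lt_ofReal_iff (by positivity)).2 ?_
    exact one_div_lt_one_div_of_lt hpos hlt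
  refine volume_eq_zero_of_distMeasure_eq_zero hE.frontier_null (hFm.diff hFm') ?_
  by_contra hI0
  have hc'0 : c' ≠ 0 := (pos_of_gt hcc).ne'
  -- `c' * I` is part of the finite energy of `F'`, because `F \ F'` lies in `E` almost everywhere.
  have hItop : I ≠ ⊤ := fun hItop => by
    change c' * I < ⊤ at hI
    rw [hItop, ENNReal.mul_top hc'0] at hI
    exact lt_irrefl _ hI
  exact absurd h3 (not_le.2 (ENNReal.mul_lt_mul_left hI0 hItop hcc))

end ObstacleFlow

end

theorem mainTheorem10 {n : ℕ} (Ω E : Set (EuclideanSpace ℝ (Fin n)))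
    (hE : ObstacleFlow.IsMinimizingHull E) (hper : ObstacleFlow.perimeter E < ⊤)
    (hΩ : Ω ⊆ E) (h h' : ℝ) (hpos : 0 < h') (hlt : h' < h)
    (F F' : Set (EuclideanSpace ℝ (Fin n)))
    (hF : ObstacleFlow.IsStep h Ω E F) (hF' : ObstacleFlow.IsStep h' Ω E F') :
    volume (F \ F') = 0 :=
  hF.minimizer.volume_diff_eq_zero_of_lt hF'.minimizer hpos hlt hE hper hΩ
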